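/- Let $G$ be a group. A Boolean ideal on $G$ is a (nonempty) family $\mathcal I$ of subsets of $G$, not containing $G$ itself, such that every subset of $A\cup B$ belongs to $\mathcal I$ whenever $A,B\in\mathcal I$. It is called invariant if $xAy\in\mathcal I$ for all $A\in\mathcal I$ and $x,y\in G$, and $G$-invariant if $gA\in\mathcal I$ for all $A\in\mathcal I$ and $g\in G$. For $A\subset G$ put $\Delta_{\mathcal I}(A)=\{g\in G: gA\cap A\notin\mathcal I\}$. For a nonempty $A\subset G$ and a Boolean ideal $\mathcal J$ on $G$ put $$\mathrm{cov}(A)=\min\{|F|:F\subset G,\ FA=G\},\qquad \mathrm{cov}_{\mathcal J}(A)=\min\{|F|:F\subset G,\ (FA)\,\triangle\, G\in\mathcal J\},$$ and let $\mathrm{cov}(\emptyset)=\mathrm{cov}_{\mathcal J}(\emptyset)=\infty$, which is larger than every cardinal. Theorem. Let $\mathcal I$ be an invariant Boolean ideal on a group $G$ such that some countable (possibly finite) subset of $G$ does not belong to $\mathcal I$. Then for every partition $G=A_1\cup\dots\cup A_n$ of $G$ into finitely many pairwise disjoint sets, at least one of the following holds: (1) $\mathrm{cov}(\Delta_{\mathcal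 I}(A_i))\le n$ for all $i\in\{1,\dots,n\}$; (2) there are an $i\in\{1,\dots,n\}$ and a $G$-invariant Boolean ideal $\mathcal J$ on $G$ such that $A_i^{-1}\notin\mathcal J$ and $\mathrm{cov}_{\mathcal J}(\Delta_{\mathcal I}(A_i))<n$. -/

import Mathlib

open scoped Pointwise

/-!
A Boolean ideal on a set `X` is a proper ideal of the Boolean algebra of all subsets of `X`,
that is, an `I : Order.Ideal (Set X)` with `I.IsProper`.
-/

/-- An ideal of subsets of a `G`-space `X` is `G`-invariant if it is closed under all the
translations `A ↦ g • A`. -/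
def IsGInvariant (G : Type*) {X : Type*} [Group G] [MulAction G X]
    (I : Order.Ideal (Set X)) : Prop :=
  ∀ (g : G) (A : Set X), A ∈ I → g • A ∈ I

/-- An ideal of subsets of a group `G` is invariant if it is closed under all the two-sided
translations `A ↦ x A y`. -/
def IsBiInvariant {G : Type*} [Group G] (I : Order.Ideal (Set G)) : Prop :=
  ∀ (x y : G) (A : Set G), A ∈ I → (fun a => x * a * y) '' A ∈ I

/-- The `I`-difference set `{g ∈ G : gA ∩ A ∉ I}` of a subset `A` of a `G`-space `X`. -/
def diffSet (G : Type*) {X : Type*} [Group G] [MulAction G X]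
    (I : Order.Ideal (Set X)) (A : Set X) : Set G :=
  {g : G | (g • A) ∩ A ∉ I}

/-- `A =_J B`: the symmetric difference of `A` and `B` belongs to `J`. -/
def EqMod {X : Type*} (J : Order.Ideal (Set X)) (A B : Set X) : Prop :=
  symmDiff A B ∈ J

/-- The covering number `min {|F| : F ⊆ G, F A = G}`. It is `⊤`, which is above every cardinal,
if there is no such `F`, that is, if `A` is empty. -/
noncomputable def cov {G : Type*} [Group G] (A : Set G) : WithTop Cardinal :=
  sInf {c | ∃ F : Set G, F * A = Set.univ ∧ c = (Cardinal.mk F : WithTop Cardinal)}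

/-- The `J`-covering number `min {|F| : F ⊆ G, F A =_J G}` of a nonempty set `A`; for the empty
set it is `⊤`, which is above every cardinal. -/
noncomputable def covMod {G : Type*} [Group G] (J : Order.Ideal (Set G)) (A : Set G) :
    WithTop Cardinal :=
  sInf {c | ∃ F : Set G, A.Nonempty ∧ EqMod J (F * A) Set.univ ∧
    c = (Cardinal.mk F : WithTop Cardinal)}

open scoped BoundedContinuousFunction
open Filter Topology

/-!
Integrate the translates of one mean against another to obtain a convolution on the means of `G`.
By Zorn's lemma, the means vanishing on `I` contain a minimal compact convex left ideal `L`, and the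
Markov–Kakutani theorem gives `φ * ψ = φ` for `φ, ψ ∈ L`.

If no mean in `L` gives any `A i` more than `1 / n`, then each gives every translate of every `A i`
exactly `1 / n`; at most `n` such translates can be disjoint modulo `I`, and a maximal family of
them yields (1). Otherwise let `φ ∈ L` maximize `φ (A i)`. Since `φ * gφ = φ`, the function
`x ↦ φ (g⁻¹ x⁻¹ A i)` is bounded by its own mean `φ (A i) > 1 / n`, so it is at most `1 / n` only
on a `φ`-null set. Hence the ideal `J` of sets whose translates have `φ`-null inverses contains
`{s | φ (s A i) ≤ 1 / n}`, and fewer than `n` translates of `A i` of mean above `1 / n` can be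
disjoint modulo `I`, which yields (2).
-/

section FixedPoint

variable {E : Type*} [AddCommGroup E] [Module ℝ E]

theorem birkhoffAverage_id_mem_of_convex {K : Set E} (hconv : Convex ℝ K) {T : E → E}
    (hT : Set.MapsTo T K K) {x : E} (hx : x ∈ K) {n : ℕ} (hn : n ≠ 0) :
    birkhoffAverage ℝ T id n x ∈ K := by
  rw [birkhoffAverage, birkhoffSum, Finset.smul_sum]
  exact hconv.sum_mem (fun _ _ => by positivity) (by simp [hn]) fun k _ => hT.iterate k hx

/-- The Markov–Kakutani fixed point theorem for one operator. -/
theorem exists_isFixedPt_of_isCompact_of_convex [TopologicalSpace E] [IsTopologicalAddGroup E]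
    [ContinuousSMul ℝ E] [T2Space E] {K : Set E} (hK : IsCompact K) (hconv : Convex ℝ K)
    (hne : K.Nonempty) (T : E →L[ℝ] E) (hT : Set.MapsTo T K K) :
    ∃ x ∈ K, Function.IsFixedPt T x := by
  obtain ⟨x₀, hx₀⟩ := hne
  let c : ℕ → E := fun n => birkhoffAverage ℝ T id (n + 1) x₀
  have hcK : ∀ n, c n ∈ K := fun n => birkhoffAverage_id_mem_of_convex hconv hT hx₀ n.succ_ne_zero
  have hTc : ∀ n, T (c n) - c n = ((n + 1 : ℕ) : ℝ)⁻¹ • (T^[n + 1] x₀ - x₀) := fun n => by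
    have hcomm : T (c n) = birkhoffAverage ℝ T id (n + 1) (T x₀) := by
      rw [map_birkhoffAverage ℝ ℝ]
      simp only [birkhoffAverage, birkhoffSum, Function.comp_apply, id_eq,
        ← Function.iterate_succ_apply', ← Function.iterate_succ_apply]
    rw [hcomm, birkhoffAverage_apply_sub_birkhoffAverage]
    rfl
  have hlim : Tendsto (fun n => T (c n) - c n) atTop (𝓝 0) := by
    have hbdd : Bornology.IsVonNBounded ℝ (K - K) := (hK.isVonNBounded ℝ).sub (hK.isVonNBounded ℝ)
    have hinv : Tendsto (fun n : ℕ => ((n + 1 : ℕ) : ℝ)⁻¹) atTop (𝓝 0) :=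
      tendsto_inv_atTop_nhds_zero_nat.comp (tendsto_add_atTop_nat 1)
    simp only [hTc]
    exact hbdd.smul_tendsto_zero
      (.of_forall fun n => Set.sub_mem_sub (hT.iterate (n + 1) hx₀) hx₀) hinv
  obtain ⟨x, hxK, hx⟩ := hK.exists_mapClusterPt_of_frequently
    (Eventually.of_forall (f := (atTop : Filter ℕ)) hcK).frequently
  obtain ⟨U, hU, hUx⟩ := mapClusterPt_iff_ultrafilter.1 hx
  refine ⟨x, hxK, sub_eq_zero.1 (tendsto_nhds_unique ?_ (hlim.mono_left hU))⟩
  exact ((T.continuous.tendsto x).comp hUx).sub hUx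

end FixedPoint

/-- The transpose of a continuous linear map, acting on weak duals. -/
noncomputable def weakDualTranspose {E F : Type*} [AddCommGroup E] [Module ℝ E]
    [TopologicalSpace E] [AddCommGroup F] [Module ℝ F] [TopologicalSpace F] (T : E →L[ℝ] F) :
    WeakDual ℝ F →L[ℝ] WeakDual ℝ E where
  toFun φ := StrongDual.toWeakDual ((WeakDual.toStrongDual φ).comp T)
  map_add' _ _ := rfl
  map_smul' _ _ := rfl
  cont := WeakDual.continuous_of_continuous_eval fun f => WeakDual.eval_continuous (T f)

section Mean

variable {X : Type*} [TopologicalSpace X]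

/-- A mean on `X` is a positive functional on the bounded continuous functions that maps `1`
to `1`. On a discrete space this encodes a finitely additive probability measure; means are taken
in the weak dual, where they form a compact set. -/
structure IsMean (φ : WeakDual ℝ (X →ᵇ ℝ)) : Prop where
  map_nonneg : ∀ f : X →ᵇ ℝ, 0 ≤ f → 0 ≤ φ f
  map_one : φ 1 = 1

theorem IsMean.mono {φ : WeakDual ℝ (X →ᵇ ℝ)} (hφ : IsMean φ) {f g : X →ᵇ ℝ}
    (h : ∀ x, f x ≤ g x) : φ f ≤ φ g := by
  have := hφ.map_nonneg (g - f) fun x => sub_nonneg.2 (h x)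
  rwa [map_sub, sub_nonneg] at this

theorem IsMean.map_smul_one {φ : WeakDual ℝ (X →ᵇ ℝ)} (hφ : IsMean φ) (c : ℝ) :
    φ (c • (1 : X →ᵇ ℝ)) = c := by
  rw [map_smul, hφ.map_one, smul_eq_mul, mul_one]

theorem IsMean.abs_le_norm {φ : WeakDual ℝ (X →ᵇ ℝ)} (hφ : IsMean φ) (f : X →ᵇ ℝ) :
    |φ f| ≤ ‖f‖ := by
  have h : ∀ x, |f x| ≤ ‖f‖ := f.norm_coe_le_norm
  refine abs_le.2 ⟨?_, ?_⟩
  · calc -‖f‖ = φ ((-‖f‖) • (1 : X →ᵇ ℝ)) := (hφ.map_smul_one _).symm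
      _ ≤ φ f := hφ.mono fun x => by simpa using (abs_le.1 (h x)).1
  · calc φ f ≤ φ (‖f‖ • (1 : X →ᵇ ℝ)) := hφ.mono fun x => by simpa using (abs_le.1 (h x)).2
      _ = ‖f‖ := hφ.map_smul_one _

variable (X) in
theorem isClosed_setOf_isMean : IsClosed {φ : WeakDual ℝ (X →ᵇ ℝ) | IsMean φ} := by
  have : {φ : WeakDual ℝ (X →ᵇ ℝ) | IsMean φ} =
      (⋂ f : X →ᵇ ℝ, ⋂ _ : 0 ≤ f, {φ | 0 ≤ φ f}) ∩ {φ | φ 1 = 1} := by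
    ext φ
    simpa using ⟨fun h => ⟨h.map_nonneg, h.map_one⟩, fun h => ⟨h.1, h.2⟩⟩
  rw [this]
  exact (isClosed_iInter fun f => isClosed_iInter fun _ =>
    isClosed_le continuous_const (WeakDual.eval_continuous f)).inter
    (isClosed_eq (WeakDual.eval_continuous _) continuous_const)

variable (X) in
theorem isCompact_setOf_isMean : IsCompact {φ : WeakDual ℝ (X →ᵇ ℝ) | IsMean φ} := by
  refine (WeakDual.isCompact_closedBall (𝕜 := ℝ) (E := X →ᵇ ℝ) 0 1).of_isClosed_subset
    (isClosed_setOf_isMean X) fun φ hφ => ?_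
  rw [Set.mem_preimage, mem_closedBall_zero_iff]
  exact ContinuousLinearMap.opNorm_le_bound _ zero_le_one fun f =>
    (hφ.abs_le_norm f).trans_eq (one_mul _).symm

theorem IsMean.convexCombination {φ ψ : WeakDual ℝ (X →ᵇ ℝ)} (hφ : IsMean φ) (hψ : IsMean ψ)
    {a b : ℝ} (ha : 0 ≤ a) (hb : 0 ≤ b) (hab : a + b = 1) : IsMean (a • φ + b • ψ) where
  map_nonneg f hf := add_nonneg (mul_nonneg ha (hφ.map_nonneg f hf))
    (mul_nonneg hb (hψ.map_nonneg f hf))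
  map_one := by
    change a * φ 1 + b * ψ 1 = 1
    rw [hφ.map_one, hψ.map_one, mul_one, mul_one, hab]

/-- The mean concentrated at a point, used to express translation as a convolution. -/
noncomputable def diracMean (x : X) : WeakDual ℝ (X →ᵇ ℝ) :=
  StrongDual.toWeakDual (BoundedContinuousFunction.evalCLM ℝ x)

theorem isMean_diracMean (x : X) : IsMean (diracMean x) :=
  ⟨fun _ hf => hf x, rfl⟩

theorem exists_isMean_tendsto_ultrafilter (U : Ultrafilter X) :
    ∃ φ : WeakDual ℝ (X →ᵇ ℝ), IsMean φ ∧ ∀ f : X →ᵇ ℝ, Tendsto f U (𝓝 (φ f)) := by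
  obtain ⟨φ, hφ, hlim⟩ := (isCompact_setOf_isMean X).ultrafilter_le_nhds (U.map diracMean)
    (le_principal_iff.2 (Eventually.of_forall (f := (U : Filter X)) isMean_diracMean))
  have hlim' : Tendsto diracMean U (𝓝 φ) := hlim
  exact ⟨φ, hφ, fun f => ((WeakDual.eval_continuous f).tendsto φ).comp hlim'⟩

end Mean

section Ind

variable {X : Type*} [TopologicalSpace X] [DiscreteTopology X]

/-- The indicator function of a subset of a discrete space, so that `φ (ind A)` is the measure
of `A` under the mean `φ`. -/
noncomputable def ind (A : Set X) : X →ᵇ ℝ :=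
  BoundedContinuousFunction.indicator A (isClopen_discrete A)

theorem ind_apply (A : Set X) (x : X) : ind A x = A.indicator 1 x := rfl

theorem ind_empty : ind (∅ : Set X) = 0 := by
  ext x
  simp [ind_apply]

theorem ind_univ : ind (Set.univ : Set X) = 1 := by
  ext x
  simp [ind_apply]

theorem ind_union_add_ind_inter (A B : Set X) :
    ind (A ∪ B) + ind (A ∩ B) = ind A + ind B := by
  ext x
  exact Set.indicator_union_add_inter_apply _ A B x

theorem map_ind_union_add_map_ind_inter (φ : WeakDual ℝ (X →ᵇ ℝ)) (A B : Set X) :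
    φ (ind (A ∪ B)) + φ (ind (A ∩ B)) = φ (ind A) + φ (ind B) := by
  rw [← map_add, ind_union_add_ind_inter, map_add]

namespace IsMean

variable {φ : WeakDual ℝ (X →ᵇ ℝ)} (hφ : IsMean φ)

include hφ

theorem ind_nonneg (A : Set X) : 0 ≤ φ (ind A) :=
  hφ.map_nonneg _ fun x => Set.indicator_nonneg (fun _ _ => zero_le_one) x

theorem ind_mono {A B : Set X} (h : A ⊆ B) : φ (ind A) ≤ φ (ind B) :=
  hφ.mono fun x => Set.indicator_le_indicator_of_subset h (fun _ => zero_le_one) x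

theorem ind_le_one (A : Set X) : φ (ind A) ≤ 1 := by
  rw [← hφ.map_one, ← ind_univ]
  exact hφ.ind_mono (Set.subset_univ A)

theorem ind_union_eq_zero {A B : Set X} (hA : φ (ind A) = 0) (hB : φ (ind B) = 0) :
    φ (ind (A ∪ B)) = 0 := by
  linarith [map_ind_union_add_map_ind_inter φ A B, hφ.ind_nonneg (A ∪ B), hφ.ind_nonneg (A ∩ B)]

theorem ind_setOf_le_eq_zero_of_map_eq {f : X →ᵇ ℝ} {a b : ℝ} (hba : b < a) (hf : ∀ x, f x ≤ a)
    (hfa : φ f = a) : φ (ind {x | f x ≤ b}) = 0 := by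
  have hle : ∀ x, ((a - b) • ind {x | f x ≤ b}) x ≤ (a • (1 : X →ᵇ ℝ) - f) x := fun x => by
    by_cases hx : f x ≤ b
    · simpa [ind_apply, hx] using by linarith
    · simp [ind_apply, hx, hf x]
  have h : (a - b) * φ (ind {x | f x ≤ b}) ≤ 0 := by
    simpa only [map_smul, map_sub, hφ.map_smul_one, hfa, sub_self, smul_eq_mul] using hφ.mono hle
  exact le_antisymm (nonpos_of_mul_nonpos_right h (sub_pos.2 hba)) (hφ.ind_nonneg _)

theorem one_le_sum_ind_of_iUnion_eq_univ {ι : Type*} [Fintype ι] {A : ι → Set X}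
    (hcover : ⋃ i, A i = Set.univ) : 1 ≤ ∑ i, φ (ind (A i)) := by
  rw [← map_sum, ← hφ.map_one]
  refine hφ.mono fun x => ?_
  obtain ⟨i, hi⟩ := Set.mem_iUnion.1 (hcover ▸ Set.mem_univ x)
  calc (1 : X →ᵇ ℝ) x = ind (A i) x := by simp [ind_apply, hi]
    _ ≤ ∑ j, ind (A j) x := Finset.single_le_sum (f := fun j => ind (A j) x)
        (fun j _ => Set.indicator_nonneg (fun _ _ => zero_le_one) x) (Finset.mem_univ i)
    _ = (∑ j, ind (A j)) x := by rw [BoundedContinuousFunction.coe_sum, Finset.sum_apply]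

theorem one_le_card_mul_ind_of_iUnion_eq_univ {ι : Type*} [Fintype ι] {A : ι → Set X}
    (hcover : ⋃ i, A i = Set.univ) (hle : ∀ i, Fintype.card ι * φ (ind (A i)) ≤ 1) (i : ι) :
    1 ≤ Fintype.card ι * φ (ind (A i)) := by
  by_contra! hlt
  have hsum : ∑ j, Fintype.card ι * φ (ind (A j)) < ∑ _j : ι, (1 : ℝ) :=
    Finset.sum_lt_sum (fun j _ => hle j) ⟨i, Finset.mem_univ i, hlt⟩
  rw [← Finset.mul_sum, Finset.sum_const, Finset.card_univ, nsmul_one] at hsum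
  exact hsum.not_ge
    (le_mul_of_one_le_right (Nat.cast_nonneg _) (hφ.one_le_sum_ind_of_iUnion_eq_univ hcover))

end IsMean

end Ind

theorem exists_ultrafilter_compl_mem_of_isProper {X : Type*} {I : Order.Ideal (Set X)}
    (hI : I.IsProper) : ∃ U : Ultrafilter X, ∀ B ∈ I, Bᶜ ∈ U := by
  let F : Filter X := Filter.comk (· ∈ I) I.bot_mem
    (fun _ ht _ hst => I.lower hst ht) (fun _ hs _ ht => Order.Ideal.sup_mem hs ht)
  have hF : F.NeBot := ⟨fun h => Order.Ideal.isProper_iff_top_notMem.1 hI <| by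
    simpa [F, Filter.mem_comk] using Filter.empty_mem_iff_bot.2 h⟩
  exact ⟨Ultrafilter.of F, fun B hB => Ultrafilter.of_le F (by simpa [F, Filter.mem_comk] using hB)⟩

section NullMeans

variable {X : Type*} [TopologicalSpace X] [DiscreteTopology X]

/-- The means vanishing on an ideal `I` of subsets, that is, the finitely additive probability
measures for which the members of `I` are null. -/
def nullMeans (I : Order.Ideal (Set X)) : Set (WeakDual ℝ (X →ᵇ ℝ)) :=
  {φ | IsMean φ ∧ ∀ B ∈ I, φ (ind B) = 0}

theorem isClosed_nullMeans (I : Order.Ideal (Set X)) : IsClosed (nullMeans I) := by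
  have : nullMeans I = {φ | IsMean φ} ∩ ⋂ B ∈ I, {φ | φ (ind B) = 0} := by
    ext φ
    simp [nullMeans]
  rw [this]
  exact (isClosed_setOf_isMean X).inter (isClosed_biInter fun B _ =>
    isClosed_eq (WeakDual.eval_continuous _) continuous_const)

theorem convex_nullMeans (I : Order.Ideal (Set X)) : Convex ℝ (nullMeans I) := by
  refine fun φ hφ ψ hψ a b ha hb hab => ⟨hφ.1.convexCombination hψ.1 ha hb hab, fun B hB => ?_⟩
  change a * φ (ind B) + b * ψ (ind B) = 0
  rw [hφ.2 B hB, hψ.2 B hB, mul_zero, mul_zero, add_zero]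

theorem nullMeans_nonempty {I : Order.Ideal (Set X)} (hI : I.IsProper) :
    (nullMeans I).Nonempty := by
  obtain ⟨U, hU⟩ := exists_ultrafilter_compl_mem_of_isProper hI
  obtain ⟨φ, hφ, hlim⟩ := exists_isMean_tendsto_ultrafilter U
  refine ⟨φ, hφ, fun B hB => tendsto_nhds_unique (hlim (ind B)) (tendsto_const_nhds.congr' ?_)⟩
  filter_upwards [hU B hB] with x hx
  exact (Set.indicator_of_notMem hx _).symm

theorem map_ind_biUnion_of_mem_nullMeans {ι : Type*} {I : Order.Ideal (Set X)}
    {φ : WeakDual ℝ (X →ᵇ ℝ)} (hφ : φ ∈ nullMeans I) {B : ι → Set X} {F : Finset ι}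
    (hF : (F : Set ι).Pairwise fun s t => B s ∩ B t ∈ I) :
    φ (ind (⋃ s ∈ F, B s)) = ∑ s ∈ F, φ (ind (B s)) := by
  classical
  induction F using Finset.induction_on with
  | empty => simp [ind_empty]
  | insert a F ha ih =>
    rw [Finset.coe_insert, Set.pairwise_insert_of_notMem ha] at hF
    have hnull : B a ∩ ⋃ s ∈ F, B s ∈ I := by
      rw [Set.inter_iUnion₂]
      exact Order.Ideal.biSup_finset_mem_iff.2 fun s hs => (hF.2 s hs).1
    have hadd := map_ind_union_add_map_ind_inter φ (B a) (⋃ s ∈ F, B s)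
    rw [hφ.2 _ hnull, add_zero] at hadd
    rw [Finset.sum_insert ha, Finset.set_biUnion_insert, hadd, ih hF.1]

end NullMeans

section Convolution

variable {G X : Type*} [Monoid G] [MulAction G X] [TopologicalSpace X] [DiscreteTopology X]

/-- The translate `y ↦ f (g • y)` of a bounded function. -/
noncomputable def precompSMul (g : G) (f : X →ᵇ ℝ) : X →ᵇ ℝ :=
  f.compContinuous ⟨fun y => g • y, continuous_of_discreteTopology⟩

theorem precompSMul_apply (g : G) (f : X →ᵇ ℝ) (y : X) : precompSMul g f y = f (g • y) := rfl

theorem precompSMul_ind {G : Type*} [Group G] [MulAction G X] (g : G) (A : Set X) :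
    precompSMul g (ind A) = ind (g⁻¹ • A) := by
  classical
  ext y
  simp only [precompSMul_apply, ind_apply, Set.indicator_apply, Set.mem_inv_smul_set_iff,
    Pi.one_apply]

theorem abs_map_precompSMul_le (ψ : WeakDual ℝ (X →ᵇ ℝ)) (g : G) (f : X →ᵇ ℝ) :
    |ψ (precompSMul g f)| ≤ ‖WeakDual.toStrongDual ψ‖ * ‖f‖ :=
  ((WeakDual.toStrongDual ψ).le_opNorm _).trans
    (mul_le_mul_of_nonneg_left (f.norm_compContinuous_le _) (norm_nonneg _))

variable [TopologicalSpace G] [DiscreteTopology G]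

variable (G) in
/-- The operator averaging translates against `ψ`, which maps `f` to `g ↦ ψ (y ↦ f (g • y))`. -/
noncomputable def convOp (ψ : WeakDual ℝ (X →ᵇ ℝ)) : (X →ᵇ ℝ) →L[ℝ] (G →ᵇ ℝ) :=
  LinearMap.mkContinuous
    { toFun := fun f => BoundedContinuousFunction.ofNormedAddCommGroupDiscrete
        (fun g => ψ (precompSMul g f)) _ fun g => abs_map_precompSMul_le ψ g f
      map_add' := fun f f' => by
        ext g
        exact map_add ψ (precompSMul g f) (precompSMul g f')
      map_smul' := fun c f => by
        ext g
        exact map_smul ψ c (precompSMul g f) }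
    ‖WeakDual.toStrongDual ψ‖ fun f =>
      (BoundedContinuousFunction.norm_le (by positivity)).2 fun g => abs_map_precompSMul_le ψ g f

theorem convOp_apply (ψ : WeakDual ℝ (X →ᵇ ℝ)) (f : X →ᵇ ℝ) (g : G) :
    convOp G ψ f g = ψ (precompSMul g f) := rfl

/-- Convolution of a functional on `G` with a functional on a `G`-space: `conv φ ψ` maps `f` to
`φ (g ↦ ψ (y ↦ f (g • y)))`. -/
noncomputable def conv (φ : WeakDual ℝ (G →ᵇ ℝ)) (ψ : WeakDual ℝ (X →ᵇ ℝ)) :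
    WeakDual ℝ (X →ᵇ ℝ) :=
  weakDualTranspose (convOp G ψ) φ

theorem conv_apply (φ : WeakDual ℝ (G →ᵇ ℝ)) (ψ : WeakDual ℝ (X →ᵇ ℝ)) (f : X →ᵇ ℝ) :
    conv φ ψ f = φ (convOp G ψ f) := rfl

theorem conv_assoc (φ ψ : WeakDual ℝ (G →ᵇ ℝ)) (χ : WeakDual ℝ (X →ᵇ ℝ)) :
    conv (conv φ ψ) χ = conv φ (conv ψ χ) := by
  refine DFunLike.ext _ _ fun f => congrArg φ ?_
  ext x
  refine congrArg ψ ?_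
  ext y
  refine congrArg χ ?_
  ext z
  exact congrArg f (mul_smul x y z)

theorem conv_diracMean_apply (g : G) (ψ : WeakDual ℝ (X →ᵇ ℝ)) (f : X →ᵇ ℝ) :
    conv (diracMean g) ψ f = ψ (precompSMul g f) := rfl

theorem IsMean.conv {φ : WeakDual ℝ (G →ᵇ ℝ)} {ψ : WeakDual ℝ (X →ᵇ ℝ)} (hφ : IsMean φ)
    (hψ : IsMean ψ) : IsMean (conv φ ψ) where
  map_nonneg f hf :=
    hφ.map_nonneg _ fun g => hψ.map_nonneg (precompSMul g f) fun y => hf (g • y)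
  map_one := by
    rw [conv_apply, ← hφ.map_one]
    congr 1
    ext
    exact hψ.map_one

variable (G) in
/-- The nonempty compact convex left ideals of the convolution semigroup of means on `G`, and more
generally the nonempty compact convex sets of means on a `G`-space that are closed under
convolution with the means on `G`. -/
structure IsConvexLeftIdeal (L : Set (WeakDual ℝ (X →ᵇ ℝ))) : Prop where
  isMean : ∀ φ ∈ L, IsMean φ
  nonempty : L.Nonempty
  isCompact : IsCompact L
  convex : Convex ℝ L
  conv_mem : ∀ φ : WeakDual ℝ (G →ᵇ ℝ), IsMean φ → ∀ ψ ∈ L, conv φ ψ ∈ L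

theorem IsConvexLeftIdeal.sInter {c : Set (Set (WeakDual ℝ (X →ᵇ ℝ)))} (hne : c.Nonempty)
    (hchain : IsChain (· ⊆ ·) c) (hc : ∀ L ∈ c, IsConvexLeftIdeal G L) :
    IsConvexLeftIdeal G (⋂₀ c) where
  isMean φ hφ := by
    obtain ⟨L, hL⟩ := hne
    exact (hc L hL).isMean φ (hφ L hL)
  nonempty := by
    have : Nonempty c := hne.to_subtype
    have hdir : DirectedOn (· ⊇ ·) c := IsChain.directedOn hchain.symm
    exact IsCompact.nonempty_sInter_of_directed_nonempty_isCompact_isClosed hdir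
      (fun L hL => (hc L hL).nonempty) (fun L hL => (hc L hL).isCompact)
      (fun L hL => (hc L hL).isCompact.isClosed)
  isCompact := by
    obtain ⟨L, hL⟩ := hne
    exact (hc L hL).isCompact.of_isClosed_subset
      (isClosed_sInter fun L hL => (hc L hL).isCompact.isClosed) (Set.sInter_subset_of_mem hL)
  convex := convex_sInter fun L hL => (hc L hL).convex
  conv_mem φ hφ ψ hψ L hL := (hc L hL).conv_mem φ hφ ψ (hψ L hL)

theorem IsConvexLeftIdeal.exists_minimal_subset {K : Set (WeakDual ℝ (X →ᵇ ℝ))}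
    (hK : IsConvexLeftIdeal G K) : ∃ L ⊆ K, Minimal (IsConvexLeftIdeal G) L :=
  zorn_superset_nonempty {L | IsConvexLeftIdeal G L}
    (fun c hcS hchain hne => ⟨⋂₀ c, IsConvexLeftIdeal.sInter hne hchain fun _ hL => hcS hL,
      fun _ hL => Set.sInter_subset_of_mem hL⟩) K hK

theorem conv_eq_left_of_minimal {L : Set (WeakDual ℝ (G →ᵇ ℝ))}
    (hL : Minimal (IsConvexLeftIdeal G) L) {φ ψ : WeakDual ℝ (G →ᵇ ℝ)} (hφ : φ ∈ L) (hψ : ψ ∈ L) :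
    conv φ ψ = φ := by
  let T : WeakDual ℝ (G →ᵇ ℝ) →L[ℝ] WeakDual ℝ (G →ᵇ ℝ) := weakDualTranspose (convOp G ψ)
  obtain ⟨hmean, hne, hcpt, hconv, hmul⟩ := hL.prop
  have hfix : IsConvexLeftIdeal G (L ∩ {χ | T χ = χ}) :=
    { isMean := fun χ hχ => hmean χ hχ.1
      nonempty := by
        obtain ⟨χ, hχ, hfix⟩ := exists_isFixedPt_of_isCompact_of_convex hcpt hconv hne T
          fun χ hχ => hmul χ (hmean χ hχ) ψ hψ
        exact ⟨χ, hχ, hfix⟩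
      isCompact := hcpt.inter_right (isClosed_eq T.continuous continuous_id)
      convex := hconv.inter
        (LinearMap.eqLocus (T : WeakDual ℝ (G →ᵇ ℝ) →ₗ[ℝ] WeakDual ℝ (G →ᵇ ℝ)) .id).convex
      conv_mem := fun χ hχ ρ hρ =>
        ⟨hmul χ hχ ρ hρ.1, (conv_assoc χ ρ ψ).trans (congrArg (conv χ) hρ.2)⟩ }
  exact (hL.le_of_le hfix Set.inter_subset_left hφ).2

theorem isConvexLeftIdeal_nullMeans {G : Type*} [Group G] [MulAction G X] [TopologicalSpace G]
    [DiscreteTopology G] {I : Order.Ideal (Set X)} (hI : I.IsProper) (hinv : IsGInvariant G I) :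
    IsConvexLeftIdeal G (nullMeans I) where
  isMean _ hφ := hφ.1
  nonempty := nullMeans_nonempty hI
  isCompact := (isCompact_setOf_isMean X).of_isClosed_subset (isClosed_nullMeans I)
    fun _ hφ => hφ.1
  convex := convex_nullMeans I
  conv_mem φ hφ ψ hψ := by
    refine ⟨hφ.conv hψ.1, fun B hB => ?_⟩
    have : convOp G ψ (ind B) = 0 := by
      ext g
      rw [convOp_apply, precompSMul_ind]
      exact hψ.2 _ (hinv _ _ hB)
    rw [conv_apply, this, map_zero]

end Convolution

section Packing

theorem exists_maximal_finset_pairwise {α : Type*} {r : α → α → Prop} [Std.Symm r]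
    {S : Set α} {N : ℕ}
    (hN : ∀ F : Finset α, (F : Set α) ⊆ S → (F : Set α).Pairwise r → F.card ≤ N) :
    ∃ F : Finset α, (F : Set α) ⊆ S ∧ (F : Set α).Pairwise r ∧
      ∀ s ∈ S, s ∉ F → ∃ t ∈ F, ¬ r s t := by
  classical
  let P : Set (Finset α) := {F | (F : Set α) ⊆ S ∧ (F : Set α).Pairwise r}
  have hfin : (Finset.card '' P).Finite :=
    (Set.finite_Iic N).subset (Set.image_subset_iff.2 fun F hF => hN F hF.1 hF.2)
  obtain ⟨F, ⟨hFS, hF⟩, hmax⟩ := hfin.exists_maximalFor' _ P ⟨∅, by simp [P]⟩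
  refine ⟨F, hFS, hF, fun s hs hsF => ?_⟩
  by_contra! h
  have hins : insert s F ∈ P := by
    refine ⟨?_, ?_⟩ <;> rw [Finset.coe_insert]
    · exact Set.insert_subset hs hFS
    · exact hF.insert fun t ht _ => ⟨h t ht, Std.Symm.symm _ _ (h t ht)⟩
  have hle := hmax hins (Finset.card_le_card (Finset.subset_insert s F))
  rw [Finset.card_insert_of_notMem hsF] at hle
  omega

theorem card_le_of_one_le_mul_of_sum_le_one {α : Type*} {F : Finset α} {a : α → ℝ} {n : ℕ}
    (ha : ∀ s ∈ F, 1 ≤ n * a s) (hsum : ∑ s ∈ F, a s ≤ 1) : F.card ≤ n := by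
  have : (F.card : ℝ) ≤ n := calc
    (F.card : ℝ) = ∑ _s ∈ F, (1 : ℝ) := by simp
    _ ≤ ∑ s ∈ F, n * a s := Finset.sum_le_sum ha
    _ = n * ∑ s ∈ F, a s := (Finset.mul_sum ..).symm
    _ ≤ n := mul_le_of_le_one_right (Nat.cast_nonneg n) hsum
  exact_mod_cast this

theorem card_lt_of_one_lt_mul_of_sum_le_one {α : Type*} {F : Finset α} (hF : F.Nonempty)
    {a : α → ℝ} {n : ℕ} (ha : ∀ s ∈ F, 1 < n * a s) (hsum : ∑ s ∈ F, a s ≤ 1) : F.card < n := by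
  have : (F.card : ℝ) < n := calc
    (F.card : ℝ) = ∑ _s ∈ F, (1 : ℝ) := by simp
    _ < ∑ s ∈ F, n * a s := Finset.sum_lt_sum_of_nonempty hF ha
    _ = n * ∑ s ∈ F, a s := (Finset.mul_sum ..).symm
    _ ≤ n := mul_le_of_le_one_right (Nat.cast_nonneg n) hsum
  exact_mod_cast this

theorem mem_mul_diffSet {G X : Type*} [Group G] [MulAction G X] {I : Order.Ideal (Set X)}
    (hinv : IsGInvariant G I) {A : Set X} {F : Set G} {s t : G} (ht : t ∈ F)
    (hst : s • A ∩ t • A ∉ I) : s ∈ F * diffSet G I A := by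
  refine ⟨t, ht, t⁻¹ * s, fun h => hst ?_, mul_inv_cancel_left t s⟩
  have := hinv t _ h
  rwa [Set.smul_set_inter, ← mul_smul, mul_inv_cancel_left] at this

variable {G X : Type*} [Group G] [MulAction G X] [TopologicalSpace X] [DiscreteTopology X]
  {I : Order.Ideal (Set X)} {φ : WeakDual ℝ (X →ᵇ ℝ)}

theorem exists_finset_subset_mul_diffSet (hinv : IsGInvariant G I) (hφ : φ ∈ nullMeans I)
    {A : Set X} {S : Set G} {N : ℕ} (hS : ∀ s ∈ S, 1 ≤ N * φ (ind (s • A))) :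
    ∃ F : Finset G, (F : Set G) ⊆ S ∧ ∑ s ∈ F, φ (ind (s • A)) ≤ 1 ∧
      S ⊆ F * diffSet G I A := by
  have hsum : ∀ F : Finset G, (F : Set G).Pairwise (fun s t => s • A ∩ t • A ∈ I) →
      ∑ s ∈ F, φ (ind (s • A)) ≤ 1 := fun F hF => by
    rw [← map_ind_biUnion_of_mem_nullMeans hφ hF]
    exact hφ.1.ind_le_one _
  have hcard : ∀ F : Finset G, (F : Set G) ⊆ S →
      (F : Set G).Pairwise (fun s t => s • A ∩ t • A ∈ I) → F.card ≤ N := fun F hFS hF =>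
    card_le_of_one_le_mul_of_sum_le_one (fun s hs => hS s (hFS hs)) (hsum F hF)
  have : Std.Symm fun s t : G => s • A ∩ t • A ∈ I := ⟨fun s t hst => by rwa [Set.inter_comm]⟩
  obtain ⟨F, hFS, hF, hmax⟩ := exists_maximal_finset_pairwise hcard
  refine ⟨F, hFS, hsum F hF, fun s hs => ?_⟩
  by_cases hsF : s ∈ F
  · refine mem_mul_diffSet hinv hsF fun hnull => ?_
    have hone := hS s hs
    rw [hφ.2 _ (Set.inter_self (s • A) ▸ hnull), mul_zero] at hone
    exact zero_lt_one.not_ge hone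
  · obtain ⟨t, ht, hst⟩ := hmax s hs hsF
    exact mem_mul_diffSet hinv ht hst

theorem cov_le_mk {A F : Set G} (hF : F * A = Set.univ) :
    cov A ≤ (Cardinal.mk F : WithTop Cardinal) :=
  sInf_le ⟨F, hF, rfl⟩

theorem covMod_le_mk {J : Order.Ideal (Set G)} {A F : Set G} (hA : A.Nonempty)
    (hF : (F * A)ᶜ ∈ J) : covMod J A ≤ (Cardinal.mk F : WithTop Cardinal) :=
  sInf_le ⟨F, hA, by rwa [EqMod, ← Set.top_eq_univ, symmDiff_top], rfl⟩

theorem cov_diffSet_le (hinv : IsGInvariant G I) (hφ : φ ∈ nullMeans I) {A : Set X} {n : ℕ}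
    (hA : ∀ s : G, 1 ≤ n * φ (ind (s • A))) :
    cov (diffSet G I A) ≤ (n : WithTop Cardinal) := by
  obtain ⟨F, -, hsum, hF⟩ := exists_finset_subset_mul_diffSet hinv hφ (S := Set.univ)
    fun s _ => hA s
  have hcard : F.card ≤ n := card_le_of_one_le_mul_of_sum_le_one (fun s _ => hA s) hsum
  refine (cov_le_mk (Set.univ_subset_iff.1 hF)).trans (WithTop.coe_le_coe.2 ?_)
  simpa using hcard

theorem covMod_diffSet_lt (hinv : IsGInvariant G I) (hφ : φ ∈ nullMeans I) {A : Set X} {n : ℕ}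
    {J : Order.Ideal (Set G)} (hJ : J.IsProper) (hA : {s : G | n * φ (ind (s • A)) ≤ 1} ∈ J) :
    covMod J (diffSet G I A) < (n : WithTop Cardinal) := by
  let S : Set G := {s | 1 < n * φ (ind (s • A))}
  have hSJ : Sᶜ ∈ J := by simpa only [S, Set.compl_ofPred, not_lt] using hA
  obtain ⟨F, hFS, hsum, hF⟩ := exists_finset_subset_mul_diffSet hinv hφ (S := S)
    fun _ hs => hs.le
  obtain ⟨s, hs⟩ : S.Nonempty := by
    rw [Set.nonempty_iff_ne_empty]
    rintro hS
    exact Order.Ideal.isProper_iff_top_notMem.1 hJ (by simpa [hS] using hSJ)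
  obtain ⟨t, ht, d, hd, -⟩ := hF hs
  have hcard : F.card < n := card_lt_of_one_lt_mul_of_sum_le_one ⟨t, ht⟩ (fun s hs => hFS hs) hsum
  refine (covMod_le_mk ⟨d, hd⟩ (J.lower (Set.compl_subset_compl.2 hF) hSJ)).trans_lt
    (WithTop.coe_lt_coe.2 ?_)
  simpa using hcard

end Packing

section InvNullIdeal

variable {G : Type*} [Group G] [TopologicalSpace G] [DiscreteTopology G]
  {φ : WeakDual ℝ (G →ᵇ ℝ)}

/-- The largest `G`-invariant ideal consisting of sets whose inverses are null for a given mean. -/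
def invNullIdeal (hφ : IsMean φ) : Order.Ideal (Set G) where
  carrier := {B | ∀ g : G, φ (ind (g • B)⁻¹) = 0}
  lower' _ _ hCB hB g := le_antisymm
    ((hφ.ind_mono (Set.inv_subset_inv.2 (Set.smul_set_mono hCB))).trans (hB g).le)
    (hφ.ind_nonneg _)
  nonempty' := ⟨∅, fun g => by rw [Set.smul_set_empty, Set.inv_empty, ind_empty, map_zero]⟩
  directed' B hB C hC := ⟨B ∪ C, fun g => by
    rw [Set.smul_set_union, Set.union_inv]
    exact hφ.ind_union_eq_zero (hB g) (hC g), Set.subset_union_left, Set.subset_union_right⟩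

theorem mem_invNullIdeal (hφ : IsMean φ) {B : Set G} :
    B ∈ invNullIdeal hφ ↔ ∀ g : G, φ (ind (g • B)⁻¹) = 0 := Iff.rfl

theorem inv_notMem_invNullIdeal (hφ : IsMean φ) {A : Set G} (hA : φ (ind A) ≠ 0) :
    A⁻¹ ∉ invNullIdeal hφ :=
  fun h => hA (by simpa using (mem_invNullIdeal hφ).1 h 1)

theorem isProper_invNullIdeal (hφ : IsMean φ) : (invNullIdeal hφ).IsProper :=
  Order.Ideal.isProper_of_notMem (inv_notMem_invNullIdeal hφ (A := Set.univ)
    (by rw [ind_univ, hφ.map_one]; exact one_ne_zero))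

theorem isGInvariant_invNullIdeal (hφ : IsMean φ) : IsGInvariant G (invNullIdeal hφ) :=
  fun g B hB h => by
    rw [← mul_smul]
    exact hB (h * g)

theorem setOf_ind_smul_le_mem_invNullIdeal {L : Set (WeakDual ℝ (G →ᵇ ℝ))}
    (hL : Minimal (IsConvexLeftIdeal G) L) (hφL : φ ∈ L) {A : Set G}
    (hmax : IsMaxOn (fun ψ => ψ (ind A)) L φ) {b : ℝ} (hb : b < φ (ind A)) :
    {s : G | φ (ind (s • A)) ≤ b} ∈ invNullIdeal (hL.prop.isMean φ hφL) := by
  have htranslate : ∀ g : G, ∀ ψ ∈ L, conv (diracMean g) ψ ∈ L :=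
    fun g ψ => hL.prop.conv_mem _ (isMean_diracMean g) ψ
  refine (mem_invNullIdeal _).2 fun g => ?_
  let ψ := conv (diracMean g) φ
  have hψ : ψ ∈ L := htranslate g φ hφL
  have hle : ∀ x, convOp G ψ (ind A) x ≤ φ (ind A) := fun x => hmax (htranslate x ψ hψ)
  have heq : φ (convOp G ψ (ind A)) = φ (ind A) := by
    rw [← conv_apply, conv_eq_left_of_minimal hL hφL hψ]
  have hset : (g • {s : G | φ (ind (s • A)) ≤ b})⁻¹ = {x | convOp G ψ (ind A) x ≤ b} := by
    ext x
    rw [Set.mem_inv, Set.mem_smul_set_iff_inv_smul_mem, Set.mem_ofPred_eq, Set.mem_ofPred_eq,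
      convOp_apply, precompSMul_ind, conv_diracMean_apply, precompSMul_ind, smul_eq_mul, mul_smul]
  rw [hset]
  exact (hL.prop.isMean φ hφL).ind_setOf_le_eq_zero_of_map_eq hb hle heq

theorem exists_isGInvariant_covMod_diffSet_lt {I : Order.Ideal (Set G)} (hinv : IsGInvariant G I)
    {L : Set (WeakDual ℝ (G →ᵇ ℝ))} (hL : Minimal (IsConvexLeftIdeal G) L) (hLI : L ⊆ nullMeans I)
    {A : Set G} {n : ℕ} (hφL : φ ∈ L) (hφ : 1 < n * φ (ind A)) :
    ∃ J : Order.Ideal (Set G), J.IsProper ∧ IsGInvariant G J ∧ A⁻¹ ∉ J ∧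
      covMod J (diffSet G I A) < (n : WithTop Cardinal) := by
  obtain ⟨ψ, hψL, hmax⟩ := hL.prop.isCompact.exists_isMaxOn hL.prop.nonempty
    (WeakDual.eval_continuous (ind A)).continuousOn
  have hψ : IsMean ψ := hL.prop.isMean ψ hψL
  have hlt : 1 < n * ψ (ind A) :=
    hφ.trans_le (mul_le_mul_of_nonneg_left (hmax hφL) (Nat.cast_nonneg n))
  have hn : (0 : ℝ) < n := pos_of_mul_pos_left (one_pos.trans hlt) (hψ.ind_nonneg A)
  have hJ : {s : G | n * ψ (ind (s • A)) ≤ 1} ∈ invNullIdeal hψ := by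
    simpa only [inv_eq_one_div, le_div_iff₀' hn] using
      setOf_ind_smul_le_mem_invNullIdeal hL hψL hmax ((inv_lt_iff_one_lt_mul₀' hn).2 hlt)
  have hA : ψ (ind A) ≠ 0 := fun h => by
    rw [h, mul_zero] at hlt
    exact zero_lt_one.not_gt hlt
  exact ⟨invNullIdeal hψ, isProper_invNullIdeal hψ, isGInvariant_invNullIdeal hψ,
    inv_notMem_invNullIdeal hψ hA,
    covMod_diffSet_lt hinv (hLI hψL) (isProper_invNullIdeal hψ) hJ⟩

end InvNullIdeal

theorem IsBiInvariant.isGInvariant {G : Type*} [Group G] {I : Order.Ideal (Set G)}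
    (hI : IsBiInvariant I) : IsGInvariant G I := fun g A hA => by
  simpa only [mul_one, ← Set.image_smul, smul_eq_mul] using hI g 1 A hA

theorem theorem2_general {G ι : Type*} [Group G] [Fintype ι] {I : Order.Ideal (Set G)}
    (hI : I.IsProper) (hinv : IsGInvariant G I) {A : ι → Set G} (hcover : ⋃ i, A i = Set.univ) :
    (∀ i, cov (diffSet G I (A i)) ≤ (Fintype.card ι : WithTop Cardinal)) ∨
    (∃ i, ∃ J : Order.Ideal (Set G), J.IsProper ∧ IsGInvariant G J ∧ (A i)⁻¹ ∉ J ∧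
      covMod J (diffSet G I (A i)) < (Fintype.card ι : WithTop Cardinal)) := by
  let _ : TopologicalSpace G := ⊥
  have : DiscreteTopology G := ⟨rfl⟩
  obtain ⟨L, hLI, hL⟩ := (isConvexLeftIdeal_nullMeans hI hinv).exists_minimal_subset
  by_cases hbig : ∃ i, ∃ φ ∈ L, 1 < Fintype.card ι * φ (ind (A i))
  · obtain ⟨i, φ, hφL, hφ⟩ := hbig
    exact .inr ⟨i, exists_isGInvariant_covMod_diffSet_lt hinv hL hLI hφL hφ⟩
  · push Not at hbig
    obtain ⟨φ, hφL⟩ := hL.prop.nonempty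
    refine .inl fun i => cov_diffSet_le hinv (hLI hφL) fun s => ?_
    have hsφ := hL.prop.conv_mem _ (isMean_diracMean s⁻¹) φ hφL
    have hone := (hL.prop.isMean _ hsφ).one_le_card_mul_ind_of_iUnion_eq_univ hcover
      (fun j => hbig j _ hsφ) i
    rwa [conv_diracMean_apply, precompSMul_ind, inv_inv] at hone

theorem theorem2 {G : Type*} [Group G] (I : Order.Ideal (Set G)) (hI : I.IsProper)
    (hinv : IsBiInvariant I) (hctbl : ∃ C : Set G, C.Countable ∧ C ∉ I)
    (n : ℕ) (A : Fin n → Set G)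
    (hdisj : Pairwise fun i j => Disjoint (A i) (A j)) (hcover : ⋃ i, A i = Set.univ) :
    (∀ i, cov (diffSet G I (A i)) ≤ (n : WithTop Cardinal)) ∨
    (∃ i, ∃ J : Order.Ideal (Set G), J.IsProper ∧ IsGInvariant G J ∧ (A i)⁻¹ ∉ J ∧
      covMod J (diffSet G I (A i)) < (n : WithTop Cardinal)) := by
  simpa only [Fintype.card_fin] using theorem2_general hI hinv.isGInvariant hcover
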